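/- For $n\ge 1$, let $\mathcal{C}_n$ be the set of nonnesting permutations of the multiset $\{1,1,2,2,\dots,n,n\}$, that is, the words $\pi=\pi_1\pi_2\cdots\pi_{2n}$ containing each of $1,\dots,n$ exactly twice and avoiding the patterns $1221$ and $2112$. Here a word $\pi$ contains a pattern $\sigma=\sigma_1\cdots\sigma_k$ if there are indices $i_1<\dots<i_k$ such that, for all $r,s$, $\pi_{i_r}<\pi_{i_s}$ if and only if $\sigma_r<\sigma_s$, and $\pi_{i_r}=\pi_{i_s}$ if and only if $\sigma_r=\sigma_s$; otherwise $\pi$ avoids $\sigma$. Let $c_n(\sigma,\tau,\dots)$ be the number of elements of $\mathcal{C}_n$ that avoid all of the patterns $\sigma,\tau,\dots$. Let $C_n=\frac{1}{n+1}\binom{2n}{n}$ be the $n$th Catalan number, and let $F_n$ be the Fibonacci numbers with the convention $F_0=F_1=1$ and $F_n=F_{n-1}+F_{n-2}$ for $n\ge2$. Theorem. For all $n\ge1$, (a) $c_n(1123,1132)=c_n(1322,3122)=2^{n-1}C_n$; (b) $c_n(1123,1132,2133)=F_nC_n$; (c) $c_n(1123,1132,2331)=c_n(1123,1132,3122)=c_n(1332,2213,2231)=\binom{2n}{n-1}$.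 -/

import Mathlib

/-- Words over `ℕ` (both permutations of multisets and patterns are words). -/
abbrev NWord := List ℕ

/-- `w` contains the pattern `σ`: some subsequence of `w`, at the positions given by a strictly
increasing map `f`, has the same length as `σ` and is in the same relative order as `σ`, with
equal entries exactly where `σ` has equal entries. -/
def NWord.Contains (w σ : NWord) : Prop :=
  ∃ f : Fin σ.length → Fin w.length, StrictMono f ∧
    ∀ r s : Fin σ.length,
      (w.get (f r) < w.get (f s) ↔ σ.get r < σ.get s) ∧
      (w.get (f r) = w.get (f s) ↔ σ.get r = σ.get s)

/-- `w` avoids the pattern `σ`. -/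
def NWord.Avoids (w σ : NWord) : Prop := ¬ NWord.Contains w σ

/-- `w` is a permutation of the multiset `{1, 1, 2, 2, …, n, n}`. -/
def IsDoublePerm (n : ℕ) (w : NWord) : Prop :=
  List.Perm w (List.range' 1 n ++ List.range' 1 n)

/-- The set `𝒞ₙ` of nonnesting permutations of `{1, 1, …, n, n}`: those that avoid `1221` and
`2112`. -/
def nonnestingPerms (n : ℕ) : Set NWord :=
  {w | IsDoublePerm n w ∧ NWord.Avoids w [1, 2, 2, 1] ∧ NWord.Avoids w [2, 1, 1, 2]}

/-- The set `𝒞ₙ(Λ)` of nonnesting permutations avoiding every pattern in `Λ`. -/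
def nonnestingAvoiding (n : ℕ) (Λ : Set NWord) : Set NWord :=
  {w | w ∈ nonnestingPerms n ∧ ∀ σ ∈ Λ, NWord.Avoids w σ}

/-- `𝒞ₙ(Λ)` is finite, so that its `Set.ncard` is its genuine cardinality. -/
theorem nonnestingAvoiding_finite (n : ℕ) (Λ : Set NWord) : (nonnestingAvoiding n Λ).Finite := by
  refine ((List.range' 1 n ++ List.range' 1 n).permutations.toFinset.finite_toSet).subset ?_
  intro w hw
  simpa [IsDoublePerm] using hw.1.1

/-- The number `cₙ(Λ)` of nonnesting permutations avoiding every pattern in `Λ`. -/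
noncomputable def nonnestingCount (n : ℕ) (Λ : Set NWord) : ℕ :=
  (nonnestingAvoiding n Λ).ncard

/-- The Fibonacci numbers with the convention `F₀ = F₁ = 1`. -/
def shiftedFib (n : ℕ) : ℕ := Nat.fib (n + 1)

/-!
In a nonnesting permutation the second copies of the letters appear in the same order as the first
copies. Reading the word from left to right is therefore the same as running a first-in-first-out
queue: a first copy pushes its letter and a second copy pops the oldest letter. So the word amounts
to the permutation `l` of `1, …, n` spelled by its first copies together with the Dyck word that
tells first copies from second ones.

If `a` precedes `b` in `l`, then the word contains both `aab` and `abb`, but neither `baa` nor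
`bba`. Consequently it contains `xyyz` if and only if `l` contains `xyz`; it contains `xxyz` or
`xxzy` if and only if `l` contains `xyz` or `xzy`, and symmetrically for `xyzz` and `yxzz`. Each
avoidance class thus reduces to a condition on `l` alone, and its size is the Catalan number times
the number of permutations avoiding some patterns of length three. Those are counted by recursion
on the first or the last letter, for which at most two choices remain in all cases but one (in that
case, `123, 132, 231`, the last letter is arbitrary and determines the permutation).
-/

open DyckStep List

section Lists

variable {α : Type*} {a b c : α} {l : List α}

theorem triplewise_iff_forall_sublist {p : α → α → α → Prop} :
    l.Triplewise p ↔ ∀ a b c, [a, b, c] <+ l → p a b c := by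
  induction l with
  | nil => simp
  | cons x l ih =>
    simp only [triplewise_cons, pairwise_iff_forall_sublist, ih, cons_sublist_cons']
    grind

theorem triplewise_and {p q : α → α → α → Prop} :
    l.Triplewise (fun a b c => p a b c ∧ q a b c) ↔ l.Triplewise p ∧ l.Triplewise q := by
  simp only [triplewise_iff_forall_sublist, ← forall_and]

theorem triplewise_congr_of_nodup {p q : α → α → α → Prop} (hl : l.Nodup)
    (h : ∀ a b c, a ≠ b → a ≠ c → b ≠ c → (p a b c ↔ q a b c)) :
    l.Triplewise p ↔ l.Triplewise q := by
  simp only [triplewise_iff_forall_sublist]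
  refine forall₃_congr fun a b c => forall_congr' fun hs => ?_
  have hd := hl.sublist hs
  simp only [nodup_cons, mem_cons, not_mem_nil, or_false, not_or] at hd
  exact h a b c hd.1.1 hd.1.2 hd.2.1

theorem pair_sublist_or_pair_sublist (hab : a ≠ b) (ha : a ∈ l) (hb : b ∈ l) :
    [a, b] <+ l ∨ [b, a] <+ l := by
  induction l with
  | nil => simp at ha
  | cons x l ih =>
    simp only [cons_sublist_cons', singleton_sublist, mem_cons] at *
    grind

theorem triple_sublist_of_nodup (hl : l.Nodup) (hab : [a, b] <+ l) (hbc : [b, c] <+ l) :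
    [a, b, c] <+ l := by
  induction l with
  | nil => simp at hab
  | cons x l ih =>
    have hb : [a, b] <+ l → b ∈ l := fun h => h.subset (by simp)
    simp only [nodup_cons, cons_sublist_cons', singleton_sublist] at *
    grind

theorem not_sublist_baa_of_sublist_abb [DecidableEq α] (hab : a ≠ b) (ha : l.count a ≤ 2)
    (hb : l.count b ≤ 2) (habb : [a, b, b] <+ l) : ¬ [b, a, a] <+ l := by
  intro hbaa
  induction l with
  | nil => simp at habb
  | cons x l ih =>
    have ha' : [b, a, a] <+ l → 2 ≤ l.count a := fun h => by simpa [hab.symm] using h.count_le a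
    have hb' : [a, b, b] <+ l → 2 ≤ l.count b := fun h => by simpa [hab] using h.count_le b
    simp only [cons_sublist_cons' (b := x), count_cons, beq_iff_eq] at *
    grind

end Lists

/-- `FifoTrace q d l w` says that a queue which initially holds `q` and obeys the commands `d`,
where `U` pushes the next letter of `l` and `D` pops the oldest letter, ends up empty with `l`
exhausted, and that the letters pushed and popped, in the order in which this happens, spell `w`.
Started from the empty queue it decodes a Dyck word `d` and a permutation `l` into a nonnesting
permutation `w`: the steps `U` mark the first copies of the letters and `D` the second copies. -/
inductive FifoTrace {α : Type*} : List α → List DyckStep → List α → List α → Prop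
  | nil : FifoTrace [] [] [] []
  | push {q d l w} (a : α) : FifoTrace (q ++ [a]) d l w → FifoTrace q (U :: d) (a :: l) (a :: w)
  | pop {q d l w} (a : α) : FifoTrace q d l w → FifoTrace (a :: q) (D :: d) l (a :: w)

namespace FifoTrace

variable {α : Type*} {q l w : List α} {d : List DyckStep}

section Dyck

theorem count_U (h : FifoTrace q d l w) : d.count U = l.length := by
  induction h <;> simp_all

theorem count_D (h : FifoTrace q d l w) : d.count D = q.length + l.length := by
  induction h with
  | nil => rfl
  | push a _ ih => grind
  | pop a _ ih => grind

theorem count_D_take_le (h : FifoTrace q d l w) (i : ℕ) :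
    (d.take i).count D ≤ q.length + (d.take i).count U := by
  induction h generalizing i with
  | nil => simp
  | push a _ ih =>
    cases i with
    | zero => simp
    | succ i => have := ih i; grind
  | pop a _ ih =>
    cases i with
    | zero => simp
    | succ i => have := ih i; grind

theorem exists_word (hU : d.count U = l.length) (hD : d.count D = q.length + l.length)
    (hle : ∀ i, (d.take i).count D ≤ q.length + (d.take i).count U) :
    ∃ w, FifoTrace q d l w := by
  induction d generalizing q l with
  | nil =>
    obtain rfl : l = [] := by simpa using hU.symm
    obtain rfl : q = [] := by simpa using hD.symm
    exact ⟨_, nil⟩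
  | cons s d ih =>
    have hle' : ∀ i, _ := fun i => hle (i + 1)
    cases s with
    | U =>
      cases l with
      | nil => simp at hU
      | cons a l =>
        obtain ⟨w, hw⟩ := ih (q := q ++ [a]) (l := l) (by simpa using hU) (by grind)
          (fun i => by have := hle' i; grind)
        exact ⟨_, hw.push a⟩
    | D =>
      cases q with
      | nil => simpa using hle 1
      | cons a q =>
        obtain ⟨w, hw⟩ := ih (q := q) (l := l) (by simpa using hU) (by grind)
          (fun i => by have := hle' i; grind)
        exact ⟨_, hw.pop a⟩

theorem exists_word_of_dyckWord (p : DyckWord) (hl : l.length = p.semilength) :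
    ∃ w, FifoTrace [] p.toList l w :=
  exists_word hl.symm (by rw [← p.count_U_eq_count_D, length_nil, zero_add, hl]; rfl)
    (by simpa using p.count_D_le_count_U)

theorem exists_dyckWord (h : FifoTrace [] d l w) :
    ∃ p : DyckWord, p.toList = d ∧ p.semilength = l.length :=
  ⟨⟨d, by simp [h.count_U, h.count_D], by simpa using h.count_D_take_le⟩, rfl, h.count_U⟩

end Dyck

section Uniqueness

theorem word_unique {w' : List α} (h : FifoTrace q d l w) (h' : FifoTrace q d l w') : w = w' := by
  induction h generalizing w' with
  | nil => cases h'; rfl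
  | push a h ih => cases h' with | push _ h' => rw [ih h']
  | pop a _ ih => cases h' with | pop _ h' => rw [ih h']

theorem code_unique {d' : List DyckStep} {l' : List α} (h : FifoTrace q d l w)
    (h' : FifoTrace q d' l' w) (hl : (q ++ l).Nodup) (hl' : (q ++ l').Nodup) :
    d = d' ∧ l = l' := by
  induction h generalizing d' l' with
  | nil => cases h'; simp
  | push a h ih =>
    cases h' with
    | push _ h' => simpa using ih h' (by simpa using hl) (by simpa using hl')
    | pop _ h' => simp at hl
  | pop a _ ih =>
    cases h' with
    | push _ h' => simp at hl'
    | pop _ h' => simpa using ih h' (nodup_cons.1 hl).2 (nodup_cons.1 hl').2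

end Uniqueness

section Subwords

theorem count_eq [DecidableEq α] (h : FifoTrace q d l w) (a : α) :
    w.count a = q.count a + 2 * l.count a := by
  induction h with
  | nil => rfl
  | push b h ih => simp only [count_cons, count_append, count_nil] at *; omega
  | pop b h ih => simp only [count_cons] at *; omega

theorem count_le_two [DecidableEq α] (h : FifoTrace [] d l w) (hl : l.Nodup) (a : α) :
    w.count a ≤ 2 := by
  have := nodup_iff_count_le_one.1 hl a
  rw [h.count_eq, count_nil]
  omega

theorem mem_of_mem (h : FifoTrace q d l w) {a : α} (ha : a ∈ w) : a ∈ q ++ l := by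
  induction h <;> grind

theorem append_sublist (h : FifoTrace q d l w) : q ++ l <+ w := by
  induction h with
  | nil => simp
  | push a _ ih => simpa using ih.cons a
  | pop a h ih => simpa using ih

theorem double_sublist_append (h : FifoTrace q d l w) {u v : List α} {a : α}
    (hs : u ++ a :: v <+ q ++ l) : u ++ a :: a :: v <+ q ++ w := by
  induction h generalizing u with
  | nil => simp at hs
  | push b _ ih => simpa using ih (u := u) (by simpa using hs)
  | @pop q d l w b h ih =>
    have hsub : q ++ w <+ b :: q ++ b :: w := by simp
    cases u with
    | nil =>
      rw [nil_append, cons_append, cons_sublist_cons'] at hs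
      rcases hs with hs | ⟨rfl, hs⟩
      · exact (ih (u := []) hs).trans hsub
      · have hw : a :: v <+ a :: w := (hs.trans h.append_sublist).cons_cons a
        exact (hw.trans (sublist_append_right q _)).cons_cons a
    | cons c u =>
      rw [cons_append, cons_append, cons_sublist_cons'] at hs
      rcases hs with hs | ⟨rfl, hs⟩
      · exact (ih (u := c :: u) hs).trans hsub
      · exact ((ih hs).trans ((sublist_cons_self c w).append_left q)).cons_cons c

theorem double_sublist (h : FifoTrace [] d l w) {u v : List α} {a : α} (hs : u ++ a :: v <+ l) :
    u ++ a :: a :: v <+ w :=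
  h.double_sublist_append hs

theorem pair_sublist_of_abb (h : FifoTrace [] d l w) (hl : l.Nodup) {a b : α} (hab : a ≠ b)
    (hs : [a, b, b] <+ w) : [a, b] <+ l := by
  classical
  have ha : a ∈ l := h.mem_of_mem (hs.subset (by simp))
  have hb : b ∈ l := h.mem_of_mem (hs.subset (by simp))
  refine (pair_sublist_or_pair_sublist hab ha hb).resolve_right fun hba => ?_
  exact not_sublist_baa_of_sublist_abb hab (h.count_le_two hl a) (h.count_le_two hl b) hs
    (h.double_sublist (u := [b]) hba)

theorem pair_sublist_of_aab (h : FifoTrace [] d l w) (hl : l.Nodup) {a b : α} (hab : a ≠ b)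
    (hs : [a, a, b] <+ w) : [a, b] <+ l := by
  classical
  have ha : a ∈ l := h.mem_of_mem (hs.subset (by simp))
  have hb : b ∈ l := h.mem_of_mem (hs.subset (by simp))
  refine (pair_sublist_or_pair_sublist hab ha hb).resolve_right fun hba => ?_
  have hbba : [b, b, a] <+ w := h.double_sublist (u := []) hba
  exact not_sublist_baa_of_sublist_abb hab (l := w.reverse)
    (by simpa using h.count_le_two hl a) (by simpa using h.count_le_two hl b)
    (by simpa using hbba.reverse) (by simpa using hs.reverse)

theorem triple_sublist_of_aabc (h : FifoTrace [] d l w) (hl : l.Nodup) {a b c : α} (hab : a ≠ b)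
    (hac : a ≠ c) (hbc : b ≠ c) (hs : [a, a, b, c] <+ w) :
    [a, b, c] <+ l ∨ [a, c, b] <+ l := by
  have hb : [a, b] <+ l := h.pair_sublist_of_aab hl hab (Sublist.trans (by simp) hs)
  have hc : [a, c] <+ l := h.pair_sublist_of_aab hl hac (Sublist.trans (by simp) hs)
  exact (pair_sublist_or_pair_sublist hbc (hb.subset (by simp)) (hc.subset (by simp))).imp
    (triple_sublist_of_nodup hl hb) (triple_sublist_of_nodup hl hc)

theorem triple_sublist_of_abbc (h : FifoTrace [] d l w) (hl : l.Nodup) {a b c : α} (hab : a ≠ b)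
    (hbc : b ≠ c) (hs : [a, b, b, c] <+ w) : [a, b, c] <+ l :=
  triple_sublist_of_nodup hl (h.pair_sublist_of_abb hl hab (Sublist.trans (by simp) hs))
    (h.pair_sublist_of_aab hl hbc (Sublist.trans (by simp) hs))

theorem triple_sublist_of_abcc (h : FifoTrace [] d l w) (hl : l.Nodup) {a b c : α} (hab : a ≠ b)
    (hac : a ≠ c) (hbc : b ≠ c) (hs : [a, b, c, c] <+ w) :
    [a, b, c] <+ l ∨ [b, a, c] <+ l := by
  have ha : [a, c] <+ l := h.pair_sublist_of_abb hl hac (Sublist.trans (by simp) hs)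
  have hb : [b, c] <+ l := h.pair_sublist_of_abb hl hbc (Sublist.trans (by simp) hs)
  exact (pair_sublist_or_pair_sublist hab (ha.subset (by simp)) (hb.subset (by simp))).imp
    (triple_sublist_of_nodup hl · hb) (triple_sublist_of_nodup hl · ha)

theorem not_sublist_abba (h : FifoTrace [] d l w) (hl : l.Nodup) {a b : α} (hab : a ≠ b) :
    ¬ [a, b, b, a] <+ w := fun hs => by
  simpa using hl.sublist (h.triple_sublist_of_abbc hl hab hab.symm hs)

end Subwords

section Existence

variable [DecidableEq α]

theorem eq_of_mem_of_nonnesting {a b : α} (hq : (b :: q).Nodup) (ha : a ∈ b :: q)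
    (hcount : (b :: q ++ a :: w).count b = 2)
    (hnest : ∀ x y, x ≠ y → ¬ [x, y, y, x] <+ b :: q ++ a :: w) : a = b := by
  by_contra hab
  have haq : a ∈ q := by simpa [hab] using ha
  have hbw : b ∈ w := by
    have : (b :: q ++ a :: w).count b = 1 + w.count b := by
      simp [hab, count_eq_zero.2 (nodup_cons.1 hq).1, add_comm]
    exact count_pos_iff.1 (by omega)
  have haab : [a, a, b] <+ q ++ a :: w :=
    (singleton_sublist.2 haq).append ((singleton_sublist.2 hbw).cons_cons a)
  exact hnest b a (Ne.symm hab) (haab.cons_cons b)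

theorem exists_of_nonnesting (hq : q.Nodup) (hcount : ∀ x ∈ q ++ w, (q ++ w).count x = 2)
    (hnest : ∀ x y, x ≠ y → ¬ [x, y, y, x] <+ q ++ w) : ∃ d l, FifoTrace q d l w := by
  induction w generalizing q with
  | nil =>
    obtain rfl : q = [] := eq_nil_iff_forall_not_mem.2 fun x hx => by
      have := hcount x (by simpa using hx)
      have := nodup_iff_count_le_one.1 hq x
      simp_all
    exact ⟨_, _, nil⟩
  | cons a w ih =>
    by_cases ha : a ∈ q
    · obtain ⟨b, q, rfl⟩ := exists_cons_of_ne_nil (ne_nil_of_mem ha)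
      obtain rfl := eq_of_mem_of_nonnesting hq ha (hcount b (by simp)) hnest
      have hcount_a : (q ++ w).count a = 0 := by
        have := hcount a (by simp)
        simp only [cons_append, count_cons_self, count_append] at this ⊢
        omega
      obtain ⟨d, l, h⟩ := ih (q := q) (nodup_cons.1 hq).2
        (fun x hx => by
          have hxa : a ≠ x := by rintro rfl; exact count_eq_zero.1 hcount_a hx
          have := hcount x (by grind)
          simpa [hxa] using this)
        (fun x y hxy hs => hnest x y hxy (hs.trans (by simp)))
      exact ⟨_, _, h.pop a⟩
    · obtain ⟨d, l, h⟩ := ih (q := q ++ [a]) (by simpa [nodup_append] using ⟨hq, by grind⟩)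
        (by simpa using hcount) (by simpa using hnest)
      exact ⟨_, _, h.push a⟩

end Existence

end FifoTrace

namespace NWord

variable {w σ : NWord} {x y z : ℕ}

theorem contains_of_map_sublist {v : ℕ → ℕ} (hv : StrictMonoOn v {i | i ∈ σ})
    (hs : σ.map v <+ w) : Contains w σ := by
  obtain ⟨f, hf⟩ := sublist_iff_exists_fin_orderEmbedding_get_eq.1 hs
  have hget (i : Fin σ.length) : w.get (f (i.cast (by simp))) = v (σ.get i) := by
    rw [← hf]; simp
  refine ⟨fun i => f (i.cast (by simp)), fun i j hij => f.strictMono (by simpa using hij),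
    fun r s => ?_⟩
  rw [hget, hget]
  exact ⟨hv.lt_iff_lt (σ.get_mem r) (σ.get_mem s), hv.injOn.eq_iff (σ.get_mem r) (σ.get_mem s)⟩

theorem Contains.exists_map_sublist (h : Contains w σ) :
    ∃ v : ℕ → ℕ, StrictMonoOn v {i | i ∈ σ} ∧ σ.map v <+ w := by
  obtain ⟨f, hf, hrs⟩ := h
  have hv : (w.get ∘ f).FactorsThrough σ.get := fun i j hij => (hrs i j).2.2 hij
  refine ⟨Function.extend σ.get (w.get ∘ f) 0, ?_, ?_⟩
  · rintro r hr s hs hlt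
    obtain ⟨i, rfl⟩ := mem_iff_get.1 hr
    obtain ⟨j, rfl⟩ := mem_iff_get.1 hs
    rw [hv.extend_apply, hv.extend_apply]
    exact (hrs i j).1.2 hlt
  · rw [sublist_iff_exists_fin_orderEmbedding_get_eq]
    refine ⟨OrderEmbedding.ofStrictMono (fun i => f (i.cast (by simp)))
      fun i j hij => hf (by simpa using hij), fun i => ?_⟩
    exact Eq.trans (by simp) (hv.extend_apply 0 (i.cast (by simp)))

theorem contains_iff : Contains w σ ↔ ∃ v : ℕ → ℕ, StrictMonoOn v {i | i ∈ σ} ∧ σ.map v <+ w :=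
  ⟨Contains.exists_map_sublist, fun ⟨_, hv, hs⟩ => contains_of_map_sublist hv hs⟩

theorem contains_xyyx_iff (hxy : x ≠ y) :
    Contains w [x, y, y, x] ↔ ∃ a b, a ≠ b ∧ (a < b ↔ x < y) ∧ [a, b, b, a] <+ w := by
  rw [contains_iff]
  constructor
  · rintro ⟨v, hv, hs⟩
    have hx : x ∈ {i | i ∈ [x, y, y, x]} := by simp
    have hy : y ∈ {i | i ∈ [x, y, y, x]} := by simp
    exact ⟨v x, v y, hv.injOn.ne hx hy hxy, hv.lt_iff_lt hx hy, hs⟩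
  · rintro ⟨a, b, hab, hlt, hs⟩
    refine ⟨fun i => if i = x then a else b, ?_, by simpa [hxy.symm] using hs⟩
    intro i hi j hj hij
    simp only [Set.mem_ofPred_eq, mem_cons, not_mem_nil, or_false] at hi hj
    grind

theorem avoids_1221_and_avoids_2112_iff :
    Avoids w [1, 2, 2, 1] ∧ Avoids w [2, 1, 1, 2] ↔ ∀ a b, a ≠ b → ¬ [a, b, b, a] <+ w := by
  simp only [Avoids, contains_xyyx_iff (show 1 ≠ 2 by decide),
    contains_xyyx_iff (show 2 ≠ 1 by decide)]
  grind

theorem contains_triple_iff (hσ : [x, y, z].Nodup) (hw : w.Nodup) :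
    Contains w [x, y, z] ↔
      ∃ a b c, [a, b, c] <+ w ∧ (a < b ↔ x < y) ∧ (b < c ↔ y < z) ∧ (a < c ↔ x < z) := by
  rw [contains_iff]
  constructor
  · rintro ⟨v, hv, hs⟩
    have hx : x ∈ {i | i ∈ [x, y, z]} := by simp
    have hy : y ∈ {i | i ∈ [x, y, z]} := by simp
    have hz : z ∈ {i | i ∈ [x, y, z]} := by simp
    exact ⟨v x, v y, v z, hs, hv.lt_iff_lt hx hy, hv.lt_iff_lt hy hz, hv.lt_iff_lt hx hz⟩
  · rintro ⟨a, b, c, hs, hab, hbc, hac⟩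
    have hd := hw.sublist hs
    simp only [nodup_cons, mem_cons, not_mem_nil, or_false, not_or] at hσ hd
    refine ⟨fun i => if i = x then a else if i = y then b else c, ?_, ?_⟩
    · intro i hi j hj hij
      simp only [Set.mem_ofPred_eq, mem_cons, not_mem_nil, or_false] at hi hj
      grind
    · simpa [Ne.symm hσ.1.1, Ne.symm hσ.1.2, Ne.symm hσ.2.1] using hs

theorem avoids_triple_iff (hσ : [x, y, z].Nodup) (hw : w.Nodup) :
    Avoids w [x, y, z] ↔
      w.Triplewise fun a b c => ¬ ((a < b ↔ x < y) ∧ (b < c ↔ y < z) ∧ (a < c ↔ x < z)) := by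
  simp only [Avoids, contains_triple_iff hσ hw, triplewise_iff_forall_sublist, not_exists, not_and]

end NWord

namespace FifoTrace

variable {l w : NWord} {d : List DyckStep} {x y z : ℕ}

theorem contains_double {u v : NWord} (h : FifoTrace [] d l w)
    (hl : NWord.Contains l (u ++ x :: v)) : NWord.Contains w (u ++ x :: x :: v) := by
  rw [NWord.contains_iff] at hl ⊢
  obtain ⟨f, hf, hs⟩ := hl
  refine ⟨f, hf.mono (by grind), ?_⟩
  simpa using h.double_sublist (by simpa using hs)

theorem avoids_of_avoids_double {u v : NWord} (h : FifoTrace [] d l w)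
    (hw : NWord.Avoids w (u ++ x :: x :: v)) : NWord.Avoids l (u ++ x :: v) :=
  fun hl => hw (h.contains_double hl)

theorem avoids_xxyz (h : FifoTrace [] d l w) (hl : l.Nodup) (hσ : [x, y, z].Nodup)
    (hxyz : NWord.Avoids l [x, y, z]) (hxzy : NWord.Avoids l [x, z, y]) :
    NWord.Avoids w [x, x, y, z] := by
  intro hw
  obtain ⟨v, hv, hs⟩ := hw.exists_map_sublist
  replace hv : StrictMonoOn v {i | i ∈ [x, y, z]} := hv.mono fun i => by simp
  have hd : [v x, v y, v z].Nodup := hσ.map_on fun _ hi _ hj => hv.injOn hi hj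
  simp only [nodup_cons, mem_cons, not_mem_nil, or_false, not_or] at hd
  rcases h.triple_sublist_of_aabc hl hd.1.1 hd.1.2 hd.2.1 hs with hs | hs
  · exact hxyz (NWord.contains_of_map_sublist hv hs)
  · exact hxzy (NWord.contains_of_map_sublist (hv.mono (by grind)) hs)

theorem avoids_xyyz (h : FifoTrace [] d l w) (hl : l.Nodup) (hσ : [x, y, z].Nodup)
    (hxyz : NWord.Avoids l [x, y, z]) : NWord.Avoids w [x, y, y, z] := by
  intro hw
  obtain ⟨v, hv, hs⟩ := hw.exists_map_sublist
  replace hv : StrictMonoOn v {i | i ∈ [x, y, z]} := hv.mono fun i => by simp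
  have hd : [v x, v y, v z].Nodup := hσ.map_on fun _ hi _ hj => hv.injOn hi hj
  simp only [nodup_cons, mem_cons, not_mem_nil, or_false, not_or] at hd
  exact hxyz (NWord.contains_of_map_sublist hv (h.triple_sublist_of_abbc hl hd.1.1 hd.2.1 hs))

theorem avoids_xyzz (h : FifoTrace [] d l w) (hl : l.Nodup) (hσ : [x, y, z].Nodup)
    (hxyz : NWord.Avoids l [x, y, z]) (hyxz : NWord.Avoids l [y, x, z]) :
    NWord.Avoids w [x, y, z, z] := by
  intro hw
  obtain ⟨v, hv, hs⟩ := hw.exists_map_sublist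
  replace hv : StrictMonoOn v {i | i ∈ [x, y, z]} := hv.mono fun i => by simp
  have hd : [v x, v y, v z].Nodup := hσ.map_on fun _ hi _ hj => hv.injOn hi hj
  simp only [nodup_cons, mem_cons, not_mem_nil, or_false, not_or] at hd
  rcases h.triple_sublist_of_abcc hl hd.1.1 hd.1.2 hd.2.1 hs with hs | hs
  · exact hxyz (NWord.contains_of_map_sublist hv hs)
  · exact hyxz (NWord.contains_of_map_sublist (hv.mono (by grind)) hs)

theorem forall_avoids_1123_1132_iff (h : FifoTrace [] d l w) (hl : l.Nodup) :
    (∀ σ ∈ ({[1, 1, 2, 3], [1, 1, 3, 2]} : Set NWord), NWord.Avoids w σ) ↔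
      ∀ σ ∈ ({[1, 2, 3], [1, 3, 2]} : Set NWord), NWord.Avoids l σ := by
  simp only [Set.mem_insert_iff, Set.mem_singleton_iff, forall_eq_or_imp, forall_eq]
  constructor
  · rintro ⟨h₁₁₂₃, h₁₁₃₂⟩
    exact ⟨h.avoids_of_avoids_double (u := []) h₁₁₂₃, h.avoids_of_avoids_double (u := []) h₁₁₃₂⟩
  · rintro ⟨h₁₂₃, h₁₃₂⟩
    exact ⟨h.avoids_xxyz hl (by decide) h₁₂₃ h₁₃₂, h.avoids_xxyz hl (by decide) h₁₃₂ h₁₂₃⟩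

theorem forall_avoids_1322_3122_iff (h : FifoTrace [] d l w) (hl : l.Nodup) :
    (∀ σ ∈ ({[1, 3, 2, 2], [3, 1, 2, 2]} : Set NWord), NWord.Avoids w σ) ↔
      ∀ σ ∈ ({[1, 3, 2], [3, 1, 2]} : Set NWord), NWord.Avoids l σ := by
  simp only [Set.mem_insert_iff, Set.mem_singleton_iff, forall_eq_or_imp, forall_eq]
  constructor
  · rintro ⟨h₁₃₂₂, h₃₁₂₂⟩
    exact ⟨h.avoids_of_avoids_double (u := [1, 3]) h₁₃₂₂,
      h.avoids_of_avoids_double (u := [3, 1]) h₃₁₂₂⟩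
  · rintro ⟨h₁₃₂, h₃₁₂⟩
    exact ⟨h.avoids_xyzz hl (by decide) h₁₃₂ h₃₁₂, h.avoids_xyzz hl (by decide) h₃₁₂ h₁₃₂⟩

theorem forall_avoids_1123_1132_2133_iff (h : FifoTrace [] d l w) (hl : l.Nodup) :
    (∀ σ ∈ ({[1, 1, 2, 3], [1, 1, 3, 2], [2, 1, 3, 3]} : Set NWord), NWord.Avoids w σ) ↔
      ∀ σ ∈ ({[1, 2, 3], [1, 3, 2], [2, 1, 3]} : Set NWord), NWord.Avoids l σ := by
  have h₁₁ := h.forall_avoids_1123_1132_iff hl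
  simp only [Set.mem_insert_iff, Set.mem_singleton_iff, forall_eq_or_imp, forall_eq,
    ← and_assoc] at h₁₁ ⊢
  rw [h₁₁, and_congr_right_iff]
  rintro ⟨h₁₂₃, -⟩
  exact ⟨fun h₂₁₃₃ => h.avoids_of_avoids_double (u := [2, 1]) h₂₁₃₃,
    fun h₂₁₃ => h.avoids_xyzz hl (by decide) h₂₁₃ h₁₂₃⟩

theorem forall_avoids_1123_1132_2331_iff (h : FifoTrace [] d l w) (hl : l.Nodup) :
    (∀ σ ∈ ({[1, 1, 2, 3], [1, 1, 3, 2], [2, 3, 3, 1]} : Set NWord), NWord.Avoids w σ) ↔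
      ∀ σ ∈ ({[1, 2, 3], [1, 3, 2], [2, 3, 1]} : Set NWord), NWord.Avoids l σ := by
  have h₁₁ := h.forall_avoids_1123_1132_iff hl
  simp only [Set.mem_insert_iff, Set.mem_singleton_iff, forall_eq_or_imp, forall_eq,
    ← and_assoc] at h₁₁ ⊢
  rw [h₁₁, and_congr_right_iff]
  rintro -
  exact ⟨fun h₂₃₃₁ => h.avoids_of_avoids_double (u := [2]) h₂₃₃₁,
    fun h₂₃₁ => h.avoids_xyyz hl (by decide) h₂₃₁⟩

theorem forall_avoids_1123_1132_3122_iff (h : FifoTrace [] d l w) (hl : l.Nodup) :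
    (∀ σ ∈ ({[1, 1, 2, 3], [1, 1, 3, 2], [3, 1, 2, 2]} : Set NWord), NWord.Avoids w σ) ↔
      ∀ σ ∈ ({[1, 2, 3], [1, 3, 2], [3, 1, 2]} : Set NWord), NWord.Avoids l σ := by
  have h₁₁ := h.forall_avoids_1123_1132_iff hl
  simp only [Set.mem_insert_iff, Set.mem_singleton_iff, forall_eq_or_imp, forall_eq,
    ← and_assoc] at h₁₁ ⊢
  rw [h₁₁, and_congr_right_iff]
  rintro ⟨-, h₁₃₂⟩
  exact ⟨fun h₃₁₂₂ => h.avoids_of_avoids_double (u := [3, 1]) h₃₁₂₂,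
    fun h₃₁₂ => h.avoids_xyzz hl (by decide) h₃₁₂ h₁₃₂⟩

theorem forall_avoids_1332_2213_2231_iff (h : FifoTrace [] d l w) (hl : l.Nodup) :
    (∀ σ ∈ ({[1, 3, 3, 2], [2, 2, 1, 3], [2, 2, 3, 1]} : Set NWord), NWord.Avoids w σ) ↔
      ∀ σ ∈ ({[1, 3, 2], [2, 1, 3], [2, 3, 1]} : Set NWord), NWord.Avoids l σ := by
  simp only [Set.mem_insert_iff, Set.mem_singleton_iff, forall_eq_or_imp, forall_eq]
  constructor
  · rintro ⟨h₁₃₃₂, h₂₂₁₃, h₂₂₃₁⟩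
    exact ⟨h.avoids_of_avoids_double (u := [1]) h₁₃₃₂,
      h.avoids_of_avoids_double (u := []) h₂₂₁₃, h.avoids_of_avoids_double (u := []) h₂₂₃₁⟩
  · rintro ⟨h₁₃₂, h₂₁₃, h₂₃₁⟩
    exact ⟨h.avoids_xyyz hl (by decide) h₁₃₂, h.avoids_xxyz hl (by decide) h₂₁₃ h₂₃₁,
      h.avoids_xxyz hl (by decide) h₂₃₁ h₂₁₃⟩

end FifoTrace

section Arrangements

open scoped Finset

variable {α : Type*} {S : Finset α} {l : List α}

/-- The words in which each element of `S` occurs exactly once and nothing else occurs. -/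
def arrangements (S : Finset α) : Finset (List α) := ⟨S.val.lists, Multiset.lists_nodup_finset S⟩

theorem mem_arrangements : l ∈ arrangements S ↔ l.Nodup ∧ ∀ x, x ∈ l ↔ x ∈ S := by
  rw [arrangements, Finset.mem_mk, Multiset.mem_lists_iff]
  constructor
  · intro h
    have hl : (l : Multiset α) = S.val := h.symm
    exact ⟨Multiset.coe_nodup.1 (hl ▸ S.nodup), fun x => by rw [← Finset.mem_val, ← hl]; rfl⟩
  · rintro ⟨hl, hmem⟩
    exact (Multiset.Nodup.ext S.nodup (Multiset.coe_nodup.2 hl)).2 fun x => (hmem x).symm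

theorem nodup_of_mem_arrangements (hl : l ∈ arrangements S) : l.Nodup :=
  (mem_arrangements.1 hl).1

theorem mem_of_mem_arrangements (hl : l ∈ arrangements S) {x : α} : x ∈ l ↔ x ∈ S :=
  (mem_arrangements.1 hl).2 x

theorem reverse_mem_arrangements : l.reverse ∈ arrangements S ↔ l ∈ arrangements S := by
  simp only [mem_arrangements, nodup_reverse, mem_reverse]

theorem length_of_mem_arrangements (hl : l ∈ arrangements S) : l.length = #S := by
  rw [arrangements, Finset.mem_mk, Multiset.mem_lists_iff] at hl
  rw [Finset.card, hl]; rfl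

theorem card_arrangements : #(arrangements S) = (#S).factorial := by
  rw [arrangements, Finset.card_mk, ← S.coe_toList, Multiset.lists_coe, Multiset.coe_card,
    length_permutations, S.length_toList]

theorem cons_mem_arrangements [DecidableEq α] {x : α} :
    x :: l ∈ arrangements S ↔ x ∈ S ∧ l ∈ arrangements (S.erase x) := by
  simp only [mem_arrangements, nodup_cons, mem_cons, Finset.mem_erase]
  grind

theorem card_filter_arrangements_eq_sum [DecidableEq α] (hS : S.Nonempty) (P : List α → Prop)
    [DecidablePred P] : #{l ∈ arrangements S | P l} =
      ∑ x ∈ S, #{l ∈ arrangements (S.erase x) | P (x :: l)} := by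
  rw [← Finset.card_sigma]
  symm
  refine Finset.card_bij (fun y _ => y.1 :: y.2) ?_ ?_ ?_
  · rintro ⟨x, l⟩ h
    simpa [cons_mem_arrangements, and_assoc] using h
  · rintro ⟨x, l⟩ - ⟨y, m⟩ - h
    simpa using h
  · rintro (_ | ⟨x, l⟩) h
    · obtain ⟨x, hx⟩ := hS
      exact absurd ((mem_of_mem_arrangements (Finset.mem_filter.1 h).1).2 hx) not_mem_nil
    · exact ⟨⟨x, l⟩, by simpa [cons_mem_arrangements, and_assoc] using h, rfl⟩

end Arrangements

section TriplewiseCount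

open scoped Finset

variable {α : Type*} {p : α → α → α → Prop} {S : Finset α} {x y : α}

open Classical in
/-- The number of arrangements of `S` in which all three-letter subwords `[a, b, c]` satisfy
`p a b c`. -/
noncomputable def triplewiseCount (p : α → α → α → Prop) (S : Finset α) : ℕ :=
  #{l ∈ arrangements S | l.Triplewise p}

theorem triplewiseCount_swap :
    triplewiseCount (fun a b c => p c b a) S = triplewiseCount p S := by
  refine Finset.card_nbij' reverse reverse ?_ ?_ (fun _ _ => reverse_reverse _)
    (fun _ _ => reverse_reverse _) <;>
  · intro l hl
    simpa [reverse_mem_arrangements, triplewise_reverse] using hl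

theorem triplewiseCount_of_card_le_one (hS : #S ≤ 1) : triplewiseCount p S = 1 := by
  classical
  have hshort : ∀ l ∈ arrangements S, l.Triplewise p := by
    intro l hl
    refine triplewise_iff_forall_sublist.2 fun a b c hs => ?_
    have hlen : 3 ≤ l.length := hs.length_le
    rw [length_of_mem_arrangements hl] at hlen
    omega
  rw [triplewiseCount, Finset.filter_true_of_mem hshort, card_arrangements,
    Nat.factorial_eq_one.2 hS]

variable [DecidableEq α]

open Classical in
/-- The number of arrangements counted by `triplewiseCount p S` whose first letter is `x`, if
`x ∈ S`. -/
noncomputable def tailCount (p : α → α → α → Prop) (S : Finset α) (x : α) : ℕ :=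
  #{l ∈ arrangements (S.erase x) | l.Pairwise (p x) ∧ l.Triplewise p}

theorem triplewiseCount_eq_sum (hS : S.Nonempty) :
    triplewiseCount p S = ∑ x ∈ S, tailCount p S x := by
  classical
  simp only [triplewiseCount, tailCount, card_filter_arrangements_eq_sum hS, triplewise_cons]

theorem tailCount_of_pairwise (hx : ((S.erase x : Finset α) : Set α).Pairwise (p x)) :
    tailCount p S x = triplewiseCount p (S.erase x) := by
  classical
  refine congrArg Finset.card (Finset.filter_congr fun l hl => and_iff_right ?_)
  refine (nodup_of_mem_arrangements hl).pairwise_of_forall_ne fun a ha b hb hab => ?_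
  exact hx ((mem_of_mem_arrangements hl).1 ha) ((mem_of_mem_arrangements hl).1 hb) hab

theorem tailCount_eq_zero (hx : x ∈ S) (hy : y ∈ S) (hxy : x ≠ y) {z : α} (hzx : z ≠ x)
    (hzy : z ≠ y) (h : ¬ p z x y ∧ ¬ p z y x) : tailCount p S z = 0 := by
  classical
  refine Finset.card_eq_zero.2 (Finset.filter_eq_empty_iff.2 fun l hl hp => ?_)
  have hmem {a : α} (ha : a ∈ S) (hza : z ≠ a) : a ∈ l :=
    (mem_of_mem_arrangements hl).2 (Finset.mem_erase.2 ⟨hza.symm, ha⟩)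
  rcases pair_sublist_or_pair_sublist hxy (hmem hx hzx) (hmem hy hzy) with hs | hs
  · exact h.1 (pairwise_iff_forall_sublist.1 hp.1 hs)
  · exact h.2 (pairwise_iff_forall_sublist.1 hp.1 hs)

-- A word with any other first letter `z` contains `[z, x, y]` or `[z, y, x]`.
theorem triplewiseCount_eq_add (hx : x ∈ S) (hy : y ∈ S) (hxy : x ≠ y)
    (h : ∀ z ∈ S, z ≠ x → z ≠ y → ¬ p z x y ∧ ¬ p z y x) :
    triplewiseCount p S = tailCount p S x + tailCount p S y := by
  rw [triplewiseCount_eq_sum ⟨x, hx⟩]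
  refine Finset.sum_eq_add_of_mem x y hx hy hxy fun z hz hne => ?_
  exact tailCount_eq_zero hx hy hxy hne.1 hne.2 (h z hz hne.1 hne.2)

theorem tailCount_eq_triplewiseCount_erase_erase (hx : x ∈ S) (hxy : x ≠ y)
    (hpx : ((S.erase x : Finset α) : Set α).Pairwise (p x))
    (hpy : ∀ b ∈ S.erase y, ∀ c ∈ S.erase y, b ≠ c → (p y b c ↔ c ≠ x)) :
    tailCount p S y = triplewiseCount p ((S.erase y).erase x) := by
  classical
  have hxS : x ∈ S.erase y := Finset.mem_erase.2 ⟨hxy, hx⟩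
  rw [tailCount, card_filter_arrangements_eq_sum ⟨x, hxS⟩,
    Finset.sum_eq_single_of_mem x hxS fun b hb hbx => ?_]
  · refine congrArg Finset.card (Finset.filter_congr fun l hl => ?_)
    have hmem : ∀ a ∈ l, a ≠ x ∧ a ∈ S.erase y := fun a ha => by
      simpa using (mem_of_mem_arrangements hl).1 ha
    have hl' := nodup_of_mem_arrangements hl
    have hy : (x :: l).Pairwise (p y) := by
      refine pairwise_cons.2 ⟨fun c hc => ?_, hl'.pairwise_of_forall_ne fun b hb c hc hbc => ?_⟩
      · exact (hpy x hxS c (hmem c hc).2 (hmem c hc).1.symm).2 (hmem c hc).1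
      · exact (hpy b (hmem b hb).2 c (hmem c hc).2 hbc).2 (hmem c hc).1
    have hx : l.Pairwise (p x) := hl'.pairwise_of_forall_ne fun b hb c hc hbc =>
      hpx (by have := hmem b hb; simp_all) (by have := hmem c hc; simp_all) hbc
    simp only [triplewise_cons, hy, hx, true_and]
  · refine Finset.card_eq_zero.2 (Finset.filter_eq_empty_iff.2 fun l hl hp => ?_)
    have hxl : x ∈ l := (mem_of_mem_arrangements hl).2 (Finset.mem_erase.2 ⟨hbx.symm, hxS⟩)
    exact (hpy b hb x hxS hbx).1 ((pairwise_cons.1 hp.1).1 x hxl) rfl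

theorem triplewiseCount_eq_two_pow (h : ∀ T : Finset α, T.Nontrivial → ∃ x ∈ T, ∃ y ∈ T, x ≠ y ∧
      ((T.erase x : Finset α) : Set α).Pairwise (p x) ∧
      ((T.erase y : Finset α) : Set α).Pairwise (p y) ∧
      ∀ z ∈ T, z ≠ x → z ≠ y → ¬ p z x y ∧ ¬ p z y x) :
    triplewiseCount p S = 2 ^ (#S - 1) := by
  induction hn : #S using Nat.strong_induction_on generalizing S with
  | _ n ih =>
    rcases le_or_gt #S 1 with hS | hS
    · rw [triplewiseCount_of_card_le_one hS, Nat.sub_eq_zero_of_le (hn ▸ hS), pow_zero]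
    · obtain ⟨x, hx, y, hy, hxy, hpx, hpy, hz⟩ := h S (Finset.one_lt_card_iff_nontrivial.1 hS)
      rw [triplewiseCount_eq_add hx hy hxy hz, tailCount_of_pairwise hpx,
        tailCount_of_pairwise hpy, ih _ (by omega) (Finset.card_erase_of_mem hx),
        ih _ (by omega) (Finset.card_erase_of_mem hy), ← two_mul, ← pow_succ', hn]
      congr 1
      omega

theorem triplewiseCount_eq_card (hS : S.Nonempty)
    (h : ∀ T : Finset α, T.Nontrivial → ∃ x ∈ T, ∃ y ∈ T, x ≠ y ∧
      ((T.erase x : Finset α) : Set α).Pairwise (p x) ∧ tailCount p T y = 1 ∧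
      ∀ z ∈ T, z ≠ x → z ≠ y → ¬ p z x y ∧ ¬ p z y x) :
    triplewiseCount p S = #S := by
  induction hn : #S using Nat.strong_induction_on generalizing S with
  | _ n ih =>
    rcases le_or_gt #S 1 with hS' | hS'
    · rw [triplewiseCount_of_card_le_one hS']
      have := hS.card_pos
      omega
    · obtain ⟨x, hx, y, hy, hxy, hpx, hpy, hz⟩ := h S (Finset.one_lt_card_iff_nontrivial.1 hS')
      have hne : (S.erase x).Nonempty := ⟨y, Finset.mem_erase.2 ⟨hxy.symm, hy⟩⟩
      rw [triplewiseCount_eq_add hx hy hxy hz, tailCount_of_pairwise hpx, hpy,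
        ih _ (by omega) hne (Finset.card_erase_of_mem hx), hn]
      omega

end TriplewiseCount

section LinearOrder

open scoped Finset

variable {α : Type*} [LinearOrder α] {p : α → α → α → Prop} {S : Finset α} {x : α}

theorem tailCount_eq_one (hx : ∀ b ∈ S.erase x, ∀ c ∈ S.erase x, b ≠ c → (p x b c ↔ b < c))
    (hp : ∀ a b c, a < b → b < c → p a b c) : tailCount p S x = 1 := by
  refine Finset.card_eq_one.2 ⟨(S.erase x).sort, ?_⟩
  have hsort : (S.erase x).sort ∈ arrangements (S.erase x) :=
    mem_arrangements.2 ⟨Finset.sort_nodup _ _, fun _ => Finset.mem_sort _⟩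
  have htail {l : List α} (hl : l ∈ arrangements (S.erase x)) :
      l.Pairwise (p x) ↔ l.Pairwise (· < ·) := by
    simp only [pairwise_iff_forall_sublist]
    refine forall₂_congr fun b c => forall_congr' fun hs => hx b ?_ c ?_ ?_
    · exact (mem_of_mem_arrangements hl).1 (hs.subset (by simp))
    · exact (mem_of_mem_arrangements hl).1 (hs.subset (by simp))
    · simpa using (nodup_of_mem_arrangements hl).sublist hs
  ext l
  simp only [Finset.mem_filter, Finset.mem_singleton]
  constructor
  · rintro ⟨hl, hlt, -⟩
    refine ((perm_ext_iff_of_nodup (nodup_of_mem_arrangements hl) (Finset.sort_nodup _ _)).2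
      fun a => by rw [mem_of_mem_arrangements hl, Finset.mem_sort]).eq_of_pairwise' (r := (· < ·))
        ((htail hl).1 hlt) (Finset.sortedLT_sort _).pairwise
  · rintro rfl
    have hlt := (Finset.sortedLT_sort (S.erase x)).pairwise
    refine ⟨hsort, (htail hsort).2 hlt, triplewise_iff_forall_sublist.2 fun a b c hs => ?_⟩
    have := hlt.sublist hs
    simp only [pairwise_cons, mem_cons, not_mem_nil, or_false] at this
    exact hp a b c (this.1 b (Or.inl rfl)) (this.2.1 c rfl)

theorem exists_two_largest (hS : S.Nontrivial) :
    ∃ x ∈ S, ∃ y ∈ S, y < x ∧ ∀ z ∈ S, z ≠ x → z ≠ y → z < y := by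
  have hne : S.Nonempty := hS.nonempty
  have hne' : (S.erase (S.max' hne)).Nonempty := hS.erase_nonempty
  have hy := Finset.mem_erase.1 ((S.erase (S.max' hne)).max'_mem hne')
  refine ⟨_, S.max'_mem hne, _, hy.2, (S.le_max' _ hy.2).lt_of_ne hy.1, fun z hz hzx hzy => ?_⟩
  exact (Finset.le_max' _ z (Finset.mem_erase.2 ⟨hzx, hz⟩)).lt_of_ne hzy

theorem exists_least_greatest (hS : S.Nontrivial) :
    ∃ x ∈ S, ∃ y ∈ S, x < y ∧ ∀ z ∈ S, z ≠ x → z ≠ y → x < z ∧ z < y := by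
  refine ⟨_, S.min'_mem hS.nonempty, _, S.max'_mem hS.nonempty, ?_, fun z hz hzx hzy => ?_⟩
  · exact S.min'_lt_max'_of_card (Finset.one_lt_card_iff_nontrivial.2 hS)
  · exact ⟨(S.min'_le z hz).lt_of_ne hzx.symm, (S.le_max' z hz).lt_of_ne hzy⟩

theorem triplewiseCount_not_lt_and_lt :
    triplewiseCount (fun a b c : α => ¬ (a < b ∧ a < c)) S = 2 ^ (#S - 1) := by
  refine triplewiseCount_eq_two_pow fun T hT => ?_
  obtain ⟨x, hx, y, hy, hyx, hz⟩ := exists_two_largest hT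
  have hx_free : ((T.erase x : Finset α) : Set α).Pairwise fun b c => ¬ (x < b ∧ x < c) := by
    intro b _
    grind
  have hy_free : ((T.erase y : Finset α) : Set α).Pairwise fun b c => ¬ (y < b ∧ y < c) := by
    intro b hb c hc
    grind
  exact ⟨x, hx, y, hy, hyx.ne', hx_free, hy_free, by grind⟩

theorem triplewiseCount_lt_iff_lt :
    triplewiseCount (fun a b c : α => a < b ↔ a < c) S = 2 ^ (#S - 1) := by
  refine triplewiseCount_eq_two_pow fun T hT => ?_
  obtain ⟨x, hx, y, hy, hxy, hz⟩ := exists_least_greatest hT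
  have hx_free : ((T.erase x : Finset α) : Set α).Pairwise fun b c => x < b ↔ x < c := by
    intro b hb c hc
    grind
  have hy_free : ((T.erase y : Finset α) : Set α).Pairwise fun b c => y < b ↔ y < c := by
    intro b hb c hc
    grind
  exact ⟨x, hx, y, hy, hxy.ne, hx_free, hy_free, by grind⟩

theorem triplewiseCount_gt :
    triplewiseCount (fun a _ c : α => c < a) S = Nat.fib (#S + 1) := by
  induction hn : #S using Nat.strong_induction_on generalizing S with
  | _ n ih =>
    rcases le_or_gt #S 1 with hS | hS
    · rw [triplewiseCount_of_card_le_one hS]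
      obtain rfl | rfl : n = 0 ∨ n = 1 := by omega
      · rfl
      · rfl
    · obtain ⟨x, hx, y, hy, hyx, hz⟩ :=
        exists_two_largest (Finset.one_lt_card_iff_nontrivial.1 hS)
      have hpx : ((S.erase x : Finset α) : Set α).Pairwise fun _ c => c < x := by
        intro b _ c hc
        grind
      rw [triplewiseCount_eq_add hx hy hyx.ne' (by grind), tailCount_of_pairwise hpx,
        tailCount_eq_triplewiseCount_erase_erase hx hyx.ne' hpx (by grind)]
      obtain ⟨k, rfl⟩ : ∃ k, n = k + 2 := ⟨n - 2, by omega⟩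
      have hcard : #(S.erase x) = k + 1 := by rw [Finset.card_erase_of_mem hx, hn]; rfl
      have hcard' : #((S.erase y).erase x) = k := by
        rw [Finset.erase_right_comm, Finset.card_erase_of_mem (by grind), hcard]; rfl
      rw [ih _ (by omega) hcard, ih _ (by omega) hcard', add_comm, ← Nat.fib_add_two]

theorem triplewiseCount_lt (hS : S.Nonempty) :
    triplewiseCount (fun _ b c : α => b < c) S = #S := by
  rw [triplewiseCount_eq_sum hS, Finset.card_eq_sum_ones]
  exact Finset.sum_congr rfl fun x _ =>
    tailCount_eq_one (fun _ _ _ _ _ => Iff.rfl) fun _ _ _ _ hbc => hbc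

theorem triplewiseCount_lt_and_lt_or_lt_and_lt (hS : S.Nonempty) :
    triplewiseCount (fun a b c : α => (a < b ∧ a < c) ∨ (b < c ∧ c < a)) S = #S := by
  refine triplewiseCount_eq_card hS fun T hT => ?_
  obtain ⟨x, hx, y, hy, hxy, hz⟩ := exists_least_greatest hT
  have hx_free : ((T.erase x : Finset α) : Set α).Pairwise
      fun b c => (x < b ∧ x < c) ∨ (b < c ∧ c < x) := by
    intro b hb c hc
    grind
  have hy_increasing : tailCount (fun a b c : α => (a < b ∧ a < c) ∨ (b < c ∧ c < a)) T y = 1 :=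
    tailCount_eq_one (by grind) (by grind)
  exact ⟨x, hx, y, hy, hxy.ne, hx_free, hy_increasing, by grind⟩

theorem triplewiseCount_lt_and_lt_or_gt_and_gt (hS : S.Nonempty) :
    triplewiseCount (fun a b c : α => (a < b ∧ b < c) ∨ (b < a ∧ c < a)) S = #S := by
  refine triplewiseCount_eq_card hS fun T hT => ?_
  obtain ⟨x, hx, y, hy, hxy, hz⟩ := exists_least_greatest hT
  have hx_increasing : tailCount (fun a b c : α => (a < b ∧ b < c) ∨ (b < a ∧ c < a)) T x = 1 :=
    tailCount_eq_one (by grind) (by grind)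
  have hy_free : ((T.erase y : Finset α) : Set α).Pairwise
      fun b c => (y < b ∧ b < c) ∨ (b < y ∧ c < y) := by
    intro b hb c hc
    grind
  exact ⟨y, hy, x, hx, hxy.ne', hy_free, hx_increasing, by grind⟩

end LinearOrder

section AvoidingCount

open scoped Finset

variable {S : Finset ℕ}

open Classical in
/-- The number of arrangements of `S` that avoid every pattern in `Λ`; for `S = {1, …, n}` these
are the permutations in the symmetric group `𝔖ₙ` that avoid `Λ`. -/
noncomputable def avoidingCount (S : Finset ℕ) (Λ : Set NWord) : ℕ :=
  #{l ∈ arrangements S | ∀ σ ∈ Λ, NWord.Avoids l σ}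

theorem avoidingCount_eq_triplewiseCount {Λ : Set NWord} {p : ℕ → ℕ → ℕ → Prop}
    (h : ∀ l : NWord, l.Nodup → ((∀ σ ∈ Λ, NWord.Avoids l σ) ↔ l.Triplewise p)) :
    avoidingCount S Λ = triplewiseCount p S := by
  classical
  exact congrArg Finset.card (Finset.filter_congr fun l hl => h l (nodup_of_mem_arrangements hl))

theorem avoidingCount_123_132 :
    avoidingCount S {[1, 2, 3], [1, 3, 2]} = 2 ^ (#S - 1) := by
  rw [← triplewiseCount_not_lt_and_lt]
  refine avoidingCount_eq_triplewiseCount fun l hl => ?_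
  simp only [Set.mem_insert_iff, Set.mem_singleton_iff, forall_eq_or_imp, forall_eq]
  rw [NWord.avoids_triple_iff (by decide) hl, NWord.avoids_triple_iff (by decide) hl,
    ← triplewise_and]
  exact triplewise_congr_of_nodup hl fun a b c _ _ _ => by omega

theorem avoidingCount_132_312 :
    avoidingCount S {[1, 3, 2], [3, 1, 2]} = 2 ^ (#S - 1) := by
  rw [← triplewiseCount_lt_iff_lt, ← triplewiseCount_swap]
  refine avoidingCount_eq_triplewiseCount fun l hl => ?_
  simp only [Set.mem_insert_iff, Set.mem_singleton_iff, forall_eq_or_imp, forall_eq]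
  rw [NWord.avoids_triple_iff (by decide) hl, NWord.avoids_triple_iff (by decide) hl,
    ← triplewise_and]
  exact triplewise_congr_of_nodup hl fun a b c _ _ _ => by omega

theorem avoidingCount_123_132_213 :
    avoidingCount S {[1, 2, 3], [1, 3, 2], [2, 1, 3]} = Nat.fib (#S + 1) := by
  rw [← triplewiseCount_gt]
  refine avoidingCount_eq_triplewiseCount fun l hl => ?_
  simp only [Set.mem_insert_iff, Set.mem_singleton_iff, forall_eq_or_imp, forall_eq]
  rw [NWord.avoids_triple_iff (by decide) hl, NWord.avoids_triple_iff (by decide) hl,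
    NWord.avoids_triple_iff (by decide) hl,
    ← triplewise_and, ← triplewise_and]
  exact triplewise_congr_of_nodup hl fun a b c _ _ _ => by omega

theorem avoidingCount_123_132_231 (hS : S.Nonempty) :
    avoidingCount S {[1, 2, 3], [1, 3, 2], [2, 3, 1]} = #S := by
  rw [← triplewiseCount_lt hS, ← triplewiseCount_swap]
  refine avoidingCount_eq_triplewiseCount fun l hl => ?_
  simp only [Set.mem_insert_iff, Set.mem_singleton_iff, forall_eq_or_imp, forall_eq]
  rw [NWord.avoids_triple_iff (by decide) hl, NWord.avoids_triple_iff (by decide) hl,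
    NWord.avoids_triple_iff (by decide) hl,
    ← triplewise_and, ← triplewise_and]
  exact triplewise_congr_of_nodup hl fun a b c _ _ _ => by omega

theorem avoidingCount_123_132_312 (hS : S.Nonempty) :
    avoidingCount S {[1, 2, 3], [1, 3, 2], [3, 1, 2]} = #S := by
  rw [← triplewiseCount_lt_and_lt_or_lt_and_lt hS, ← triplewiseCount_swap]
  refine avoidingCount_eq_triplewiseCount fun l hl => ?_
  simp only [Set.mem_insert_iff, Set.mem_singleton_iff, forall_eq_or_imp, forall_eq]
  rw [NWord.avoids_triple_iff (by decide) hl, NWord.avoids_triple_iff (by decide) hl,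
    NWord.avoids_triple_iff (by decide) hl,
    ← triplewise_and, ← triplewise_and]
  exact triplewise_congr_of_nodup hl fun a b c _ _ _ => by omega

theorem avoidingCount_132_213_231 (hS : S.Nonempty) :
    avoidingCount S {[1, 3, 2], [2, 1, 3], [2, 3, 1]} = #S := by
  rw [← triplewiseCount_lt_and_lt_or_gt_and_gt hS]
  refine avoidingCount_eq_triplewiseCount fun l hl => ?_
  simp only [Set.mem_insert_iff, Set.mem_singleton_iff, forall_eq_or_imp, forall_eq]
  rw [NWord.avoids_triple_iff (by decide) hl, NWord.avoids_triple_iff (by decide) hl,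
    NWord.avoids_triple_iff (by decide) hl,
    ← triplewise_and, ← triplewise_and]
  exact triplewise_congr_of_nodup hl fun a b c _ _ _ => by omega

end AvoidingCount

section Bijection

variable {n : ℕ}

theorem FifoTrace.isDoublePerm_iff {d : List DyckStep} {l w : NWord} (h : FifoTrace [] d l w) :
    IsDoublePerm n w ↔ l ∈ arrangements (Finset.Icc 1 n) := by
  have hperm : l ∈ arrangements (Finset.Icc 1 n) ↔ l ~ range' 1 n := by
    have hmem (x : ℕ) : x ∈ Finset.Icc 1 n ↔ x ∈ range' 1 n := by
      rw [Finset.mem_Icc, mem_range'_1, add_comm 1, Nat.lt_succ_iff]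
    rw [mem_arrangements]
    simp only [hmem]
    exact ⟨fun hl => (perm_ext_iff_of_nodup hl.1 nodup_range').2 hl.2,
      fun hp => ⟨hp.nodup_iff.2 nodup_range', fun x => hp.mem_iff⟩⟩
  rw [hperm, IsDoublePerm, perm_iff_count, perm_iff_count]
  refine forall_congr' fun x => ?_
  rw [h.count_eq, count_append, count_nil]
  omega

theorem FifoTrace.mem_nonnestingPerms {d : List DyckStep} {l w : NWord} (h : FifoTrace [] d l w)
    (hl : l ∈ arrangements (Finset.Icc 1 n)) : w ∈ nonnestingPerms n :=
  ⟨h.isDoublePerm_iff.2 hl, NWord.avoids_1221_and_avoids_2112_iff.2 fun _ _ hab =>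
    h.not_sublist_abba (nodup_of_mem_arrangements hl) hab⟩

theorem exists_word_of_mem_arrangements {l : NWord} (hl : l ∈ arrangements (Finset.Icc 1 n))
    (p : {p : DyckWord // p.semilength = n}) : ∃ w, FifoTrace [] p.1.toList l w :=
  FifoTrace.exists_word_of_dyckWord _ <| by
    rw [length_of_mem_arrangements hl, Nat.card_Icc, Nat.add_sub_cancel, p.2]

theorem exists_code_of_mem_nonnestingPerms {w : NWord} (hw : w ∈ nonnestingPerms n) :
    ∃ l ∈ arrangements (Finset.Icc 1 n), ∃ p : {p : DyckWord // p.semilength = n},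
      FifoTrace [] p.1.toList l w := by
  have hcount : ∀ x ∈ w, w.count x = 2 := by
    intro x hx
    have hperm := perm_iff_count.1 hw.1 x
    have hle := nodup_iff_count_le_one.1 (nodup_range' (s := 1) (n := n)) x
    have hpos := count_pos_iff.2 hx
    rw [count_append] at hperm
    omega
  obtain ⟨d, l, h⟩ := FifoTrace.exists_of_nonnesting nodup_nil hcount
    (NWord.avoids_1221_and_avoids_2112_iff.1 hw.2)
  have hl := h.isDoublePerm_iff.1 hw.1
  obtain ⟨p, rfl, hp⟩ := h.exists_dyckWord
  refine ⟨l, hl, ⟨p, ?_⟩, h⟩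
  rw [hp, length_of_mem_arrangements hl, Nat.card_Icc, Nat.add_sub_cancel]

open scoped Finset in
theorem nonnestingCount_eq_mul_catalan {Λ Λ' : Set NWord}
    (hΛ : ∀ d l w, FifoTrace [] d l w → l.Nodup →
      ((∀ σ ∈ Λ, NWord.Avoids w σ) ↔ ∀ σ ∈ Λ', NWord.Avoids l σ)) :
    nonnestingCount n Λ = avoidingCount (Finset.Icc 1 n) Λ' * catalan n := by
  classical
  let codes : Finset (NWord × {p : DyckWord // p.semilength = n}) :=
    {l ∈ arrangements (Finset.Icc 1 n) | ∀ σ ∈ Λ', NWord.Avoids l σ} ×ˢ Finset.univ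
  have hcard : #codes = avoidingCount (Finset.Icc 1 n) Λ' * catalan n := by
    rw [Finset.card_product, Finset.card_univ, DyckWord.card_dyckWord_semilength_eq_catalan,
      avoidingCount]
  have hmem {c} : c ∈ codes ↔
      c.1 ∈ arrangements (Finset.Icc 1 n) ∧ ∀ σ ∈ Λ', NWord.Avoids c.1 σ := by
    simp only [codes, Finset.mem_product, Finset.mem_filter, Finset.mem_univ, and_true]
  have hnodup {c} (hc : c ∈ codes) : c.1.Nodup := nodup_of_mem_arrangements (hmem.1 hc).1
  choose! word hword using fun c hc =>
    exists_word_of_mem_arrangements (hmem.1 (show c ∈ codes from hc)).1 c.2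
  rw [← hcard, ← Set.ncard_coe_finset, nonnestingCount]
  refine (Set.ncard_congr (fun c _ => word c) ?_ ?_ ?_).symm
  · intro c hc
    exact ⟨(hword c hc).mem_nonnestingPerms (hmem.1 hc).1,
      (hΛ _ _ _ (hword c hc) (hnodup hc)).2 (hmem.1 hc).2⟩
  · intro c c' hc hc' heq
    obtain ⟨hd, hl⟩ :=
      (hword c hc).code_unique (heq ▸ hword c' hc') (hnodup hc) (hnodup hc')
    exact Prod.ext hl (Subtype.ext (DyckWord.ext hd))
  · rintro w ⟨hw, havoid⟩
    obtain ⟨l, hl, p, h⟩ := exists_code_of_mem_nonnestingPerms hw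
    have hc : (l, p) ∈ codes :=
      hmem.2 ⟨hl, (hΛ _ _ _ h (nodup_of_mem_arrangements hl)).1 havoid⟩
    exact ⟨_, hc, (hword _ hc).word_unique h⟩

end Bijection

theorem succ_mul_catalan_succ (n : ℕ) : (n + 1) * catalan (n + 1) = (2 * (n + 1)).choose n := by
  refine Nat.eq_of_mul_eq_mul_left (Nat.succ_pos (n + 1)) ?_
  calc (n + 2) * ((n + 1) * catalan (n + 1))
      = (n + 1 + 1) * catalan (n + 1) * (n + 1) := by ring
    _ = (2 * (n + 1)).choose (n + 1) * (n + 1) := by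
      rw [succ_mul_catalan_eq_centralBinom, Nat.centralBinom]
    _ = (n + 2) * (2 * (n + 1)).choose n := by
      rw [Nat.choose_succ_right_eq, mul_comm, show 2 * (n + 1) - n = n + 2 by omega]

theorem mainTheorem9 (n : ℕ) (hn : 1 ≤ n) :
    (nonnestingCount n {[1, 1, 2, 3], [1, 1, 3, 2]} = 2 ^ (n - 1) * catalan n ∧
      nonnestingCount n {[1, 3, 2, 2], [3, 1, 2, 2]} = 2 ^ (n - 1) * catalan n) ∧
    nonnestingCount n {[1, 1, 2, 3], [1, 1, 3, 2], [2, 1, 3, 3]} = shiftedFib n * catalan n ∧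
    (nonnestingCount n {[1, 1, 2, 3], [1, 1, 3, 2], [2, 3, 3, 1]} = (2 * n).choose (n - 1) ∧
      nonnestingCount n {[1, 1, 2, 3], [1, 1, 3, 2], [3, 1, 2, 2]} = (2 * n).choose (n - 1) ∧
      nonnestingCount n {[1, 3, 3, 2], [2, 2, 1, 3], [2, 2, 3, 1]} = (2 * n).choose (n - 1)) := by
  have hne : (Finset.Icc 1 n).Nonempty := Finset.nonempty_Icc.2 hn
  have hcard : (Finset.Icc 1 n).card = n := by simp
  have hchoose : n * catalan n = (2 * n).choose (n - 1) := by
    obtain ⟨k, rfl⟩ := Nat.exists_eq_add_of_le' hn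
    exact succ_mul_catalan_succ k
  refine ⟨⟨?_, ?_⟩, ?_, ?_, ?_, ?_⟩
  · rw [nonnestingCount_eq_mul_catalan fun _ _ _ h => h.forall_avoids_1123_1132_iff,
      avoidingCount_123_132, hcard]
  · rw [nonnestingCount_eq_mul_catalan fun _ _ _ h => h.forall_avoids_1322_3122_iff,
      avoidingCount_132_312, hcard]
  · rw [nonnestingCount_eq_mul_catalan fun _ _ _ h => h.forall_avoids_1123_1132_2133_iff,
      avoidingCount_123_132_213, hcard, shiftedFib]
  · rw [nonnestingCount_eq_mul_catalan fun _ _ _ h => h.forall_avoids_1123_1132_2331_iff,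
      avoidingCount_123_132_231 hne, hcard, hchoose]
  · rw [nonnestingCount_eq_mul_catalan fun _ _ _ h => h.forall_avoids_1123_1132_3122_iff,
      avoidingCount_123_132_312 hne, hcard, hchoose]
  · rw [nonnestingCount_eq_mul_catalan fun _ _ _ h => h.forall_avoids_1332_2213_2231_iff,
      avoidingCount_132_213_231 hne, hcard, hchoose]
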